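/- Let $G$ be a finite group with centre $Z(G)$, let $z=|Z(G)|$, and suppose $G/Z(G)\cong D_{2n}$, the dihedral group of order $2n$, where $n\ge 3$ (so $G$ is non-abelian). The CCC-graph $\Gamma_G$ is the simple graph whose vertices are the conjugacy classes of the non-central elements of $G$, two distinct classes being adjacent if and only if some element of one commutes with some element of the other. For a finite graph $\mathcal{G}$ with vertices $v_1,\dots,v_N$, let $CN(\mathcal G)$ be the $N\times N$ matrix with zero diagonal whose $(i,j)$ entry for $i\ne j$ is the number of common neighbours of $v_i$ and $v_j$, let $CNRS(\mathcal G)$ be the diagonal matrix of the row sums of $CN(\mathcal G)$, and let $\Delta=\operatorname{tr}(CNRS(\mathcal G))/N$. The CNL-energy (respectively CNSL-energy) of $\mathcal G$ is $\sum_i|\lambda_i-\Delta|$, where $\lambda_1,\dots,\lambda_N$ are the eigenvalues, with multiplicity, of $CNRS(\mathcal G)-CN(\mathcal G)$ (respectively of $CNRS(\mathcal G)+CN(\mathcal G)$). The graph $\mathcal G$ is CNL-hyperenergetic (CNSL-hyperenergetic) if its CNL-energy (CNSL-energy) is greater than $2(N-1)(N-2)$, and CNL-borderenergetic (CNSL-borderenergetic)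 if it is equal to $2(N-1)(N-2)$. Then: 1. $\Gamma_G$ is CNL-borderenergetic if and only if $n\in\{3,11\}$ and $z=1$. 2. $\Gamma_G$ is CNL-hyperenergetic if and only if $(n,z)$ is neither $(3,1)$ nor $(11,1)$ and none of the following holds: $n\in\{4,6\}$ and $z=2$; $n=4$ and $z\in\{3,4\}$; $n=3$ and $z\ge 2$; $n\in\{5,7,9\}$ and $z=1$; $n=5$ and $z\in\{2,3\}$. 3. $\Gamma_G$ is CNSL-borderenergetic if and only if $n=3$ and $z=1$. 4. $\Gamma_G$ is CNSL-hyperenergetic if and only if $(n,z)\ne(3,1)$ and none of the following holds: $n=4$ and $z\in\{2,3,4,5\}$; $n\in\{6,8\}$ and $z=2$; $n=6$ and $z=3$; $n=5$ and $z=1$; $n=3$ and $z\ge 2$; $n\ge 7$ odd and $z=1$; $n\in\{5,7,9\}$ and $z=2$; $n=5$ and $z\in\{3,4\}$. -/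

import Mathlib

noncomputable section

namespace CCC

/-- The vertices of the CCC-graph: conjugacy classes of non-central elements. -/
abbrev Vertex (G : Type*) [Group G] : Type _ :=
  {c : ConjClasses G // ∃ x : G, x ∉ Subgroup.center G ∧ ConjClasses.mk x = c}

instance (G : Type*) [Group G] [Finite G] : Fintype (Vertex G) := by
  haveI : Finite (ConjClasses G) := Finite.of_surjective _ ConjClasses.mk_surjective
  exact Fintype.ofFinite _

/-- The commuting conjugacy class graph (CCC-graph) of a group. -/
def graph (G : Type*) [Group G] : SimpleGraph (Vertex G) where
  Adj c d := c ≠ d ∧ ∃ x y : G, ConjClasses.mk x = c.1 ∧ ConjClasses.mk y = d.1 ∧ x * y = y * x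
  symm := ⟨fun _ _ ⟨hne, x, y, hx, hy, h⟩ => ⟨hne.symm, y, x, hy, hx, h.symm⟩⟩
  loopless := ⟨fun _ h => h.1 rfl⟩

end CCC

namespace SimpleGraph

variable {V : Type*} [Fintype V] (Γ : SimpleGraph V)

open scoped Classical in
/-- The common neighborhood matrix; a common neighbor of `v` and `w` is automatically
different from both. -/
def cnMatrix : Matrix V V ℝ :=
  Matrix.of fun v w => if v = w then 0 else ((Γ.commonNeighbors v w).ncard : ℝ)

open scoped Classical in
/-- The diagonal matrix of the row sums of the common neighborhood matrix. -/
def cnrsMatrix : Matrix V V ℝ :=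
  Matrix.diagonal fun v => ∑ w, Γ.cnMatrix v w

/-- The common neighborhood Laplacian matrix. -/
def cnlMatrix : Matrix V V ℝ := Γ.cnrsMatrix - Γ.cnMatrix

/-- The common neighborhood signless Laplacian matrix. -/
def cnslMatrix : Matrix V V ℝ := Γ.cnrsMatrix + Γ.cnMatrix

open scoped Classical in
/-- The CNL-spectrum: the eigenvalues of the (real symmetric) CNL-matrix, with multiplicities. -/
def cnlSpectrum : Multiset ℝ := Γ.cnlMatrix.charpoly.roots

open scoped Classical in
/-- The CNSL-spectrum: the eigenvalues of the (real symmetric) CNSL-matrix, with multiplicities. -/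
def cnslSpectrum : Multiset ℝ := Γ.cnslMatrix.charpoly.roots

/-- The average `tr(CNRS) / |V|`. -/
def cnDelta : ℝ := Γ.cnrsMatrix.trace / (Fintype.card V : ℝ)

/-- The CNL-energy. -/
def cnlEnergy : ℝ := (Γ.cnlSpectrum.map fun a => |a - Γ.cnDelta|).sum

/-- The CNSL-energy. -/
def cnslEnergy : ℝ := (Γ.cnslSpectrum.map fun b => |b - Γ.cnDelta|).sum

/-- CNL-hyperenergetic: the CNL-energy exceeds `2 (N - 1) (N - 2)`, with `N` the order. -/
def CNLHyperenergetic : Prop :=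
  Γ.cnlEnergy > 2 * ((Fintype.card V : ℝ) - 1) * ((Fintype.card V : ℝ) - 2)

/-- CNSL-hyperenergetic: the CNSL-energy exceeds `2 (N - 1) (N - 2)`, with `N` the order. -/
def CNSLHyperenergetic : Prop :=
  Γ.cnslEnergy > 2 * ((Fintype.card V : ℝ) - 1) * ((Fintype.card V : ℝ) - 2)

/-- CNL-borderenergetic: the CNL-energy equals `2 (N - 1) (N - 2)`, with `N` the order. -/
def CNLBorderenergetic : Prop :=
  Γ.cnlEnergy = 2 * ((Fintype.card V : ℝ) - 1) * ((Fintype.card V : ℝ) - 2)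

/-- CNSL-borderenergetic: the CNSL-energy equals `2 (N - 1) (N - 2)`, with `N` the order. -/
def CNSLBorderenergetic : Prop :=
  Γ.cnslEnergy = 2 * ((Fintype.card V : ℝ) - 1) * ((Fintype.card V : ℝ) - 2)

end SimpleGraph

end

/-! The graph is a disjoint union of cliques, so both energies can be computed exactly and the
classification becomes a question about the sign of a polynomial in two natural numbers.

Let φ : G → D_{2n} be surjective with kernel Z(G). The preimage of the rotations is abelian, being
generated by the centre and one lift of `r 1`. Hence the centralizer of a non-central element over a
rotation is that whole preimage, while the centralizer of an element over `sr i` is the preimage of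
`{1, sr i}`. Two distinct vertices are therefore adjacent exactly when their images have the same
kind: rotation, even reflection or odd reflection (`CCC.graph_adj_iff`). The same centralizers give
class sizes 2 and n, and counting elements gives the clique sizes: tb once and b exactly r times,
with (t, b, r) = ((n-1)/2, z, 1) for odd n and (n-1, z/2, 2) for even n.

On a clique of size m the CNL-eigenvalues are 0 and m(m-2), and the CNSL-eigenvalues are 2(m-1)(m-2)
and (m-2)^2, the second of each pair with multiplicity m-1 (`SimpleGraph.energy_of_adj_iff`). Once
the sign of each eigenvalue minus Δ is known, the absolute values disappear, and the energy minus
2(N-1)(N-2), multiplied by N/2, is the polynomial `cnlExcess` or `cnslExcess`. It is positive away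
from a few small (t, b), which are evaluated directly. The sign pattern breaks down for n = 3 (two
equal cliques) and, for CNSL only, when b = r = 1 or (t, b, r) = (3, 1, 2); these cases are treated
separately. -/

/-! ### Spectrum of a matrix with constant diagonal and constant off-diagonal entries -/

open Polynomial in
theorem Matrix.charpoly_roots_diag_const {ι : Type*} [Fintype ι] [DecidableEq ι] [Nonempty ι]
    (c d : ℝ) :
    (Matrix.of fun i j : ι => if i = j then c else d).charpoly.roots =
      (c + (Fintype.card ι - 1) * d) ::ₘ Multiset.replicate (Fintype.card ι - 1) (c - d) := by
  -- A rank-one matrix shifted by a scalar, so the characteristic polynomial is that of `vecMulVec`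
  -- translated by d - c.
  have h : (Matrix.of fun i j : ι => if i = j then c else d) =
      Matrix.vecMulVec (fun _ : ι => d) (fun _ : ι => 1) - Matrix.scalar ι (d - c) := by
    ext i j
    by_cases hij : i = j <;> simp [hij, Matrix.vecMulVec_apply]
  have hc : 1 ≤ Fintype.card ι := Fintype.card_pos
  have key : (Matrix.of fun i j : ι => if i = j then c else d).charpoly =
      (X - C (c - d)) ^ (Fintype.card ι - 1) * (X - C (c + (Fintype.card ι - 1) * d)) := by
    rw [h, Matrix.charpoly_sub_scalar, Matrix.charpoly_vecMulVec]
    obtain ⟨k, hk⟩ := Nat.exists_eq_add_of_le hc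
    rw [hk]
    simp [dotProduct, hk, smul_eq_C_mul]
    ring
  rw [key, roots_mul (mul_ne_zero (pow_ne_zero _ (X_sub_C_ne_zero _)) (X_sub_C_ne_zero _)),
    roots_pow, roots_X_sub_C, roots_X_sub_C, Multiset.nsmul_singleton, add_comm,
    Multiset.singleton_add]

/-! ### Energies of disjoint unions of cliques -/

noncomputable section

namespace SimpleGraph

variable {V I : Type*} [Fintype V] {Γ : SimpleGraph V} {f : V → I}

/-- The number of vertices in a fibre of a labelling. -/
def fiberCard {V I : Type*} (f : V → I) (i : I) : ℕ := Nat.card {v // f v = i}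

open scoped Classical in
theorem cnMatrix_apply_of_adj_iff (h : ∀ v w, Γ.Adj v w ↔ v ≠ w ∧ f v = f w) (v w : V) :
    Γ.cnMatrix v w = if v = w then 0 else if f v = f w then (fiberCard f (f v) : ℝ) - 2 else 0 := by
  simp only [cnMatrix, Matrix.of_apply]
  split_ifs with hvw hf
  · rfl
  · have hset : Γ.commonNeighbors v w =
        (((Finset.univ.filter fun u => f u = f v).erase v).erase w : Finset V) := by
      ext u
      simp only [mem_commonNeighbors, h, Finset.coe_erase, Finset.coe_filter, Finset.mem_univ,
        true_and, Set.mem_sdiff, Set.mem_ofPred_eq, Set.mem_singleton_iff]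
      rw [← hf]
      grind
    have h1 : w ∈ (Finset.univ.filter fun u => f u = f v).erase v := by
      simp [hf, Ne.symm hvw]
    have h2 : v ∈ Finset.univ.filter fun u => f u = f v := by simp
    rw [hset, Set.ncard_coe_finset, Finset.cast_card_erase_of_mem h1,
      Finset.cast_card_erase_of_mem h2, fiberCard, Nat.card_eq_fintype_card,
      Fintype.card_subtype]
    ring
  · have hset : Γ.commonNeighbors v w = ∅ := by
      ext u
      simp only [mem_commonNeighbors, h, Set.mem_empty_iff_false, iff_false]
      grind
    simp [hset]

theorem sum_cnMatrix_of_adj_iff (h : ∀ v w, Γ.Adj v w ↔ v ≠ w ∧ f v = f w) (v : V) :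
    ∑ w, Γ.cnMatrix v w = ((fiberCard f (f v) : ℝ) - 1) * (fiberCard f (f v) - 2) := by
  classical
  have h2 : v ∈ Finset.univ.filter fun u => f u = f v := by simp
  have hs (w : V) : Γ.cnMatrix v w = if w ∈ (Finset.univ.filter fun u => f u = f v).erase v
      then (fiberCard f (f v) : ℝ) - 2 else 0 := by
    rw [cnMatrix_apply_of_adj_iff h]
    simp only [Finset.mem_erase, Finset.mem_filter, Finset.mem_univ, true_and]
    grind
  simp_rw [hs]
  rw [Finset.sum_ite_mem, Finset.univ_inter, Finset.sum_const, nsmul_eq_mul,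
    Finset.cast_card_erase_of_mem h2, fiberCard, Nat.card_eq_fintype_card,
      Fintype.card_subtype]

theorem sum_comp_eq_sum_fiberCard [Fintype I] (f : V → I) (g : I → ℝ) :
    ∑ v, g (f v) = ∑ i, fiberCard f i * g i := by
  classical
  rw [← Finset.sum_fiberwise Finset.univ f]
  refine Finset.sum_congr rfl fun i _ => ?_
  rw [Finset.sum_congr rfl (g := fun _ => g i) (by simp +contextual), Finset.sum_const,
    nsmul_eq_mul, fiberCard, Nat.card_eq_fintype_card,
      Fintype.card_subtype]

theorem card_eq_sum_fiberCard [Fintype I] (f : V → I) :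
    (Fintype.card V : ℝ) = ∑ i, (fiberCard f i : ℝ) := by
  simpa using sum_comp_eq_sum_fiberCard f fun _ => 1

theorem cnDelta_of_adj_iff [Fintype I] (h : ∀ v w, Γ.Adj v w ↔ v ≠ w ∧ f v = f w) :
    Γ.cnDelta = (∑ i, (fiberCard f i : ℝ) * ((fiberCard f i - 1) * (fiberCard f i - 2))) /
      ∑ i, (fiberCard f i : ℝ) := by
  classical
  rw [cnDelta, card_eq_sum_fiberCard f, cnrsMatrix, Matrix.trace_diagonal]
  simp_rw [sum_cnMatrix_of_adj_iff h]
  rw [sum_comp_eq_sum_fiberCard f fun i => ((fiberCard f i : ℝ) - 1) * (fiberCard f i - 2)]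

/-- The contribution to an energy of a component that is complete on `m` vertices: `ε = -1` for
the Laplacian, `ε = 1` for the signless Laplacian. -/
def cliqueEnergy (ε Δ : ℝ) (m : ℕ) : ℝ :=
  if m = 0 then 0 else
    |(1 + ε) * (m - 1) * (m - 2) - Δ| + (m - 1) * |(m - 1 - ε) * (m - 2) - Δ|

-- The matrix is block diagonal along the labelling, hence block triangular for any linear order on
-- the labels, and its characteristic polynomial is a product over blocks of the constant form
-- treated above. Taking `ε = -1` or `ε = 1` handles both energies at once.
open scoped Classical in
theorem energy_of_adj_iff [Fintype I] [LinearOrder I]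
    (h : ∀ v w, Γ.Adj v w ↔ v ≠ w ∧ f v = f w) (ε Δ : ℝ) :
    ((Γ.cnrsMatrix + ε • Γ.cnMatrix).charpoly.roots.map fun a => |a - Δ|).sum =
      ∑ i, cliqueEnergy ε Δ (fiberCard f i) := by
  set M := Γ.cnrsMatrix + ε • Γ.cnMatrix with hM
  have hMap (v w : V) : M v w = (if v = w then ((fiberCard f (f v) : ℝ) - 1) *
      (fiberCard f (f v) - 2) else if f v = f w then ε * ((fiberCard f (f v) : ℝ) - 2) else 0) := by
    simp only [hM, Matrix.add_apply, Matrix.smul_apply, cnrsMatrix, Matrix.diagonal_apply,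
      sum_cnMatrix_of_adj_iff h, smul_eq_mul]
    rw [cnMatrix_apply_of_adj_iff h]
    split_ifs <;> simp
  have hbt : M.BlockTriangular f := by
    intro v w hvw
    rw [hMap, if_neg (by rintro rfl; exact lt_irrefl _ hvw), if_neg hvw.ne']
  have hblock (i : I) : M.toSquareBlock f i = Matrix.of fun v w : {v // f v = i} => if v = w then
      ((fiberCard f i : ℝ) - 1) * (fiberCard f i - 2) else ε * ((fiberCard f i : ℝ) - 2) := by
    ext ⟨v, hv⟩ ⟨w, hw⟩
    simp [Matrix.toSquareBlock_def, hMap, hv, hw]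
  rw [hbt.charpoly, Polynomial.roots_prod _ _ (Finset.prod_ne_zero_iff.2 fun i _ =>
    (Matrix.charpoly_monic _).ne_zero), Multiset.map_bind, Multiset.sum_bind]
  -- The product runs only over labels that occur; the others add nothing because `cliqueEnergy` is
  -- set to 0 at `m = 0`, where its general formula would not vanish.
  have hsub : ∑ i ∈ Finset.univ.image f, cliqueEnergy ε Δ (fiberCard f i) =
      ∑ i, cliqueEnergy ε Δ (fiberCard f i) := by
    refine Finset.sum_subset (Finset.subset_univ _) fun i _ hi => ?_
    have : fiberCard f i = 0 := by
      rw [fiberCard, Nat.card_eq_zero]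
      exact Or.inl ⟨fun ⟨v, hv⟩ => hi (Finset.mem_image.2 ⟨v, Finset.mem_univ _, hv⟩)⟩
    simp [cliqueEnergy, this]
  rw [← hsub]
  refine congrArg Multiset.sum (Multiset.map_congr ?_ fun i hi => ?_)
  · congr!
  obtain ⟨v, -, hv⟩ := Finset.mem_image.1 hi
  have : Nonempty {v // f v = i} := ⟨⟨v, hv⟩⟩
  have h0 : 0 < fiberCard f i := Nat.card_pos
  have hr := Matrix.charpoly_roots_diag_const (ι := {v // f v = i})
    (((fiberCard f i : ℝ) - 1) * (fiberCard f i - 2)) (ε * ((fiberCard f i : ℝ) - 2))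
  rw [← hblock i] at hr
  have hcard : Fintype.card {v // f v = i} = fiberCard f i :=
    Nat.card_eq_fintype_card.symm
  rw [hcard] at hr
  have hcast : ((fiberCard f i - 1 : ℕ) : ℝ) = fiberCard f i - 1 := by
    rw [Nat.cast_sub h0, Nat.cast_one]
  convert congrArg (fun s => (Multiset.map (fun a => |a - Δ|) s).sum) hr using 1
  rw [cliqueEnergy, if_neg h0.ne', Multiset.map_cons, Multiset.sum_cons, Multiset.map_replicate,
    Multiset.sum_replicate, nsmul_eq_mul, hcast]
  congr 3 <;> ring_nf

theorem cnlEnergy_of_adj_iff [Fintype I] [LinearOrder I]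
    (h : ∀ v w, Γ.Adj v w ↔ v ≠ w ∧ f v = f w) :
    Γ.cnlEnergy = ∑ i, cliqueEnergy (-1) Γ.cnDelta (fiberCard f i) := by
  rw [← energy_of_adj_iff h, cnlEnergy, cnlSpectrum, cnlMatrix, neg_one_smul, sub_eq_add_neg]

theorem cnslEnergy_of_adj_iff [Fintype I] [LinearOrder I]
    (h : ∀ v w, Γ.Adj v w ↔ v ≠ w ∧ f v = f w) :
    Γ.cnslEnergy = ∑ i, cliqueEnergy 1 Γ.cnDelta (fiberCard f i) := by
  rw [← energy_of_adj_iff h, cnslEnergy, cnslSpectrum, cnslMatrix, one_smul]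

end SimpleGraph

end

/-! ### Rotations and the parity of reflections in dihedral groups -/

noncomputable section

namespace DihedralGroup

variable {n : ℕ}

open scoped Classical in
/-- The kind of an element of a dihedral group: rotation, even reflection, or odd reflection
(the last kind is empty if `n` is odd). -/
def kind : DihedralGroup n → Fin 3
  | r _ => 0
  | sr i => if Even i then 1 else 2

@[simp] theorem kind_r (i : ZMod n) : kind (r i) = 0 := rfl

open scoped Classical in
theorem kind_sr (i : ZMod n) : kind (sr i) = if Even i then 1 else 2 := rfl

theorem kind_sr_ne_zero (i : ZMod n) : kind (sr i) ≠ 0 := by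
  rw [kind_sr]; split_ifs <;> decide

theorem kind_sr_congr {i j : ZMod n} (h : Even i ↔ Even j) : kind (sr i) = kind (sr j) := by
  rw [kind_sr, kind_sr]
  split_ifs <;> simp_all

theorem kind_sr_eq_iff {i j : ZMod n} : kind (sr i) = kind (sr j) ↔ (Even i ↔ Even j) := by
  refine ⟨fun h => ?_, kind_sr_congr⟩
  rw [kind_sr, kind_sr] at h
  split_ifs at h <;> simp_all

/-- Conjugation sends `sr b` to `sr (b - 2a)` or `sr (2a - b)`, which preserves being a double in
`ZMod n`. -/
theorem kind_conj (g x : DihedralGroup n) : kind (g * x * g⁻¹) = kind x := by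
  rcases g with a | a <;> rcases x with b | b <;>
    simp only [r_mul_r, r_mul_sr, sr_mul_r, sr_mul_sr, inv_r, inv_sr, kind_r]
  · refine kind_sr_congr ⟨?_, ?_⟩ <;> rintro ⟨c, hc⟩
    · exact ⟨c + a, by linear_combination hc⟩
    · exact ⟨c - a, by linear_combination hc⟩
  · refine kind_sr_congr ⟨?_, ?_⟩ <;> rintro ⟨c, hc⟩
    · exact ⟨a - c, by linear_combination -hc⟩
    · exact ⟨a - c, by linear_combination -hc⟩

theorem exists_eq_add_self_add_one [NeZero n] (a : ZMod n) (ha : ¬ Even a) :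
    ∃ c, a = c + c + 1 := by
  rcases Nat.even_or_odd' a.val with ⟨c, hc | hc⟩
  · exact absurd ⟨(c : ZMod n), by rw [← ZMod.natCast_zmod_val a, hc]; push_cast; ring⟩ ha
  · exact ⟨c, by rw [← ZMod.natCast_zmod_val a, hc]; push_cast; ring⟩

theorem exists_conj_sr_of_kind_eq [NeZero n] {i j : ZMod n} (h : kind (sr i) = kind (sr j)) :
    ∃ g : DihedralGroup n, g * sr j * g⁻¹ = sr i := by
  obtain ⟨c, hc⟩ : ∃ c, j - i = c + c := by
    rw [kind_sr_eq_iff] at h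
    by_cases hj : Even j
    · exact hj.sub (h.2 hj)
    · obtain ⟨a, ha⟩ := exists_eq_add_self_add_one j hj
      obtain ⟨b, hb⟩ := exists_eq_add_self_add_one i (mt h.1 hj)
      exact ⟨a - b, by linear_combination ha - hb⟩
  -- Conjugation by `r c` lowers the index of a reflection by 2c, and j - i = 2c.
  refine ⟨r c, ?_⟩
  simp only [r_mul_sr, inv_r, sr_mul_r]
  congr 1
  linear_combination hc

theorem injective_r : Function.Injective (r : ZMod n → DihedralGroup n) :=
  fun _ _ h => r.inj h

theorem injective_sr : Function.Injective (sr : ZMod n → DihedralGroup n) :=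
  fun _ _ h => sr.inj h

theorem ncard_kind_eq_zero : {d : DihedralGroup n | kind d = 0}.ncard = n := by
  have h : {d : DihedralGroup n | kind d = 0} = r '' Set.univ := by
    ext (i | i) <;> simp [kind_sr_ne_zero]
  rw [h, Set.ncard_image_of_injective _ injective_r, Set.ncard_univ, Nat.card_zmod]

theorem ncard_ne_one_kind_eq_zero [NeZero n] :
    {d : DihedralGroup n | d ≠ 1 ∧ kind d = 0}.ncard = n - 1 := by
  have h : {d : DihedralGroup n | d ≠ 1 ∧ kind d = 0} = {d | kind d = 0} \ {1} := by
    ext d; simp [and_comm]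
  have h1 : (1 : DihedralGroup n) ∈ {d : DihedralGroup n | kind d = 0} := kind_r 0
  rw [h, Set.ncard_sdiff_singleton_of_mem h1, ncard_kind_eq_zero]

theorem ncard_pair_one_sr (i : ZMod n) : ({1, sr i} : Set (DihedralGroup n)).ncard = 2 :=
  Set.ncard_pair (by rw [one_def]; simp [-r_zero])

theorem ncard_kind_eq_one :
    {d : DihedralGroup n | d ≠ 1 ∧ kind d = 1}.ncard = {i : ZMod n | Even i}.ncard := by
  have h : {d : DihedralGroup n | d ≠ 1 ∧ kind d = 1} = sr '' {i | Even i} := by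
    ext (i | i)
    · simp
    · have h1 : sr i ≠ (1 : DihedralGroup n) := by rw [one_def]; simp [-r_zero]
      by_cases hi : Even i <;> simp [kind_sr, hi, h1]
  rw [h, Set.ncard_image_of_injective _ injective_sr]

theorem ncard_kind_eq_two :
    {d : DihedralGroup n | d ≠ 1 ∧ kind d = 2}.ncard = {i : ZMod n | ¬ Even i}.ncard := by
  have h : {d : DihedralGroup n | d ≠ 1 ∧ kind d = 2} = sr '' {i | ¬ Even i} := by
    ext (i | i)
    · simp
    · have h1 : sr i ≠ (1 : DihedralGroup n) := by rw [one_def]; simp [-r_zero]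
      by_cases hi : Even i <;> simp [kind_sr, hi, h1]
  rw [h, Set.ncard_image_of_injective _ injective_sr]

theorem even_zmod_of_odd (hn : Odd n) (i : ZMod n) : Even i := by
  obtain ⟨k, rfl⟩ := hn
  have h : ((2 * k + 1 : ℕ) : ZMod (2 * k + 1)) = 0 := ZMod.natCast_self _
  push_cast at h
  -- Since 2k + 1 = 0, the inverse of 2 is -k; thus for odd n every reflection is even and the third
  -- kind is empty.
  exact ⟨-k * i, by linear_combination i * h⟩

theorem ncard_even_zmod_of_odd (hn : Odd n) : {i : ZMod n | Even i}.ncard = n := by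
  simp [even_zmod_of_odd hn, Set.ncard_univ]

theorem ncard_not_even_zmod_of_odd (hn : Odd n) : {i : ZMod n | ¬ Even i}.ncard = 0 := by
  simp [even_zmod_of_odd hn]

/-- For even n, reduction modulo 2 is well defined on `ZMod n` and kills doubles. -/
theorem not_even_add_one (hn : Even n) {i : ZMod n} (hi : Even i) : ¬ Even (i + 1) := by
  rintro ⟨b, hb⟩
  obtain ⟨a, rfl⟩ := hi
  let p := ZMod.castHom hn.two_dvd (ZMod 2)
  have h := congrArg p hb
  simp only [map_add, map_one, CharTwo.add_self_eq_zero, zero_add] at h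
  exact one_ne_zero h

theorem ncard_not_even_zmod_of_even [NeZero n] (hn : Even n) :
    {i : ZMod n | ¬ Even i}.ncard = {i : ZMod n | Even i}.ncard := by
  have h : {i : ZMod n | ¬ Even i} = (· + 1) '' {i : ZMod n | Even i} := by
    ext i
    constructor
    · intro hi
      obtain ⟨c, hc⟩ := exists_eq_add_self_add_one i hi
      exact ⟨c + c, ⟨c, rfl⟩, hc.symm⟩
    · rintro ⟨j, hj, rfl⟩
      exact not_even_add_one hn hj
  rw [h, Set.ncard_image_of_injective _ (add_left_injective 1)]

theorem two_mul_ncard_even_zmod_of_even [NeZero n] (hn : Even n) :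
    2 * {i : ZMod n | Even i}.ncard = n := by
  have h := Set.ncard_add_ncard_compl {i : ZMod n | Even i}
  have hc : {i : ZMod n | Even i}ᶜ = {i | ¬ Even i} := rfl
  rw [hc, ncard_not_even_zmod_of_even hn, Nat.card_zmod] at h
  omega

end DihedralGroup

/-! ### Centralizers, adjacency and clique sizes in the CCC-graph -/

namespace CCC

open DihedralGroup

variable {G : Type*} [Group G] {n : ℕ} {φ : G →* DihedralGroup n}

theorem mem_center_iff (hk : φ.ker = Subgroup.center G) {x : G} :
    x ∈ Subgroup.center G ↔ φ x = 1 := by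
  rw [← hk, MonoidHom.mem_ker]

theorem commute_of_map_eq (hk : φ.ker = Subgroup.center G) {x y : G} (h : φ x = φ y) :
    Commute x y := by
  have hc : x * y⁻¹ ∈ Subgroup.center G := (mem_center_iff hk).2 (by simp [h])
  have := (Subgroup.mem_center_iff.1 hc y)
  have h2 : x = (x * y⁻¹) * y := by group
  rw [h2]
  exact (show Commute (x * y⁻¹) y from this.symm).mul_left (Commute.refl y)

theorem commute_of_map_eq_r (hφ : Function.Surjective φ) (hk : φ.ker = Subgroup.center G)
    {x y : G} {i j : ZMod n} (hx : φ x = r i) (hy : φ y = r j) : Commute x y := by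
  obtain ⟨a, ha⟩ := hφ (r 1)
  have key {x : G} {i : ZMod n} (hx : φ x = r i) :
      ∃ k : ℤ, ∃ c ∈ Subgroup.center G, x = a ^ k * c := by
    obtain ⟨k, hk'⟩ := ZMod.intCast_surjective i
    refine ⟨k, (a ^ k)⁻¹ * x, (mem_center_iff hk).2 ?_, by group⟩
    rw [map_mul, map_inv, map_zpow, ha, hx, r_one_zpow, hk', inv_mul_cancel]
  obtain ⟨k, c, hc, rfl⟩ := key hx
  obtain ⟨l, d, hd, rfl⟩ := key hy
  have hc' (g : G) : Commute c g := (Subgroup.mem_center_iff.1 hc g).symm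
  have hd' (g : G) : Commute g d := Subgroup.mem_center_iff.1 hd g
  exact (((Commute.refl a).zpow_zpow k l).mul_right (hd' _)).mul_left (hc' _)

/-- Such an x commutes with everything over rotations and with y. Any g over a reflection is (gy)y⁻¹
with gy over a rotation, so x is central. -/
theorem map_eq_one_of_commute (hφ : Function.Surjective φ) (hk : φ.ker = Subgroup.center G)
    {x y : G} {i j : ZMod n} (hx : φ x = r i) (hy : φ y = sr j) (h : Commute x y) : φ x = 1 := by
  rw [← mem_center_iff hk, Subgroup.mem_center_iff]
  intro g
  rcases hg : φ g with k | k
  · exact commute_of_map_eq_r hφ hk hg hx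
  · have h1 : φ (g * y) = r (j - k) := by rw [map_mul, hg, hy, sr_mul_sr]
    have h2 : Commute x (g * y * y⁻¹) :=
      (commute_of_map_eq_r hφ hk hx h1).mul_right h.inv_right
    rw [mul_inv_cancel_right] at h2
    exact h2.symm

theorem setOf_commute_of_map_eq_r (hφ : Function.Surjective φ) (hk : φ.ker = Subgroup.center G)
    {x : G} {i : ZMod n} (hx : φ x = r i) (hx1 : φ x ≠ 1) :
    {y | Commute x y} = φ ⁻¹' {d | kind d = 0} := by
  ext y
  simp only [Set.mem_ofPred_eq, Set.mem_preimage]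
  rcases hy : φ y with j | j
  · simp [commute_of_map_eq_r hφ hk hx hy]
  · simp only [kind_sr_ne_zero, iff_false]
    exact fun h => hx1 (map_eq_one_of_commute hφ hk hx hy h)

theorem setOf_commute_of_map_eq_sr (hφ : Function.Surjective φ) (hk : φ.ker = Subgroup.center G)
    {x : G} {i : ZMod n} (hx : φ x = sr i) : {y | Commute x y} = φ ⁻¹' {1, sr i} := by
  ext y
  simp only [Set.mem_ofPred_eq, Set.mem_preimage, Set.mem_insert_iff, Set.mem_singleton_iff]
  constructor
  · intro h
    rcases hy : φ y with j | j
    · exact Or.inl (hy ▸ map_eq_one_of_commute hφ hk hy hx h.symm)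
    · have h1 : φ (x * y) = r (j - i) := by rw [map_mul, hx, hy, sr_mul_sr]
      have h2 := map_eq_one_of_commute hφ hk h1 hx ((Commute.refl x).mul_left h.symm)
      rw [h1, one_def, r.injEq, sub_eq_zero] at h2
      exact Or.inr (by rw [h2])
  · rintro (h | h)
    · exact Subgroup.mem_center_iff.1 ((mem_center_iff hk).2 h) x
    · exact commute_of_map_eq hk (hx.trans h.symm)

theorem kind_map_eq_of_isConj {x y : G} (h : IsConj x y) : kind (φ x) = kind (φ y) := by
  obtain ⟨g, rfl⟩ := isConj_iff.1 h
  simp only [map_mul, map_inv, kind_conj]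

/-- The kind of a vertex of the CCC-graph. -/
def vertexKind (φ : G →* DihedralGroup n) (c : Vertex G) : Fin 3 := kind (φ (Quotient.out c.1))

theorem vertexKind_eq {c : Vertex G} {x : G} (h : ConjClasses.mk x = c.1) :
    vertexKind φ c = kind (φ x) :=
  kind_map_eq_of_isConj <| ConjClasses.mk_eq_mk_iff_isConj.1 <|
    (Quotient.out_eq c.1).trans h.symm

theorem notMem_center_of_mk_eq {c : Vertex G} {x : G} (h : ConjClasses.mk x = c.1) :
    x ∉ Subgroup.center G := by
  obtain ⟨y, hy, hyc⟩ := c.2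
  obtain ⟨g, rfl⟩ := isConj_iff.1 (ConjClasses.mk_eq_mk_iff_isConj.1 (hyc.trans h.symm))
  intro hx
  apply hy
  have := (Subgroup.center G).normal_of_characteristic.conj_mem _ hx g⁻¹
  simpa [mul_assoc] using this

/-- The centralizers show that commuting non-central elements have the same kind. Conversely,
reflections of one kind are conjugate, so some conjugate of y has the same image as x and then
differs from it by a central factor. -/
theorem graph_adj_iff [NeZero n] (hφ : Function.Surjective φ) (hk : φ.ker = Subgroup.center G)
    (c d : Vertex G) : (graph G).Adj c d ↔ c ≠ d ∧ vertexKind φ c = vertexKind φ d := by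
  refine and_congr_right fun _ => ⟨?_, fun h => ?_⟩
  · rintro ⟨x, y, hx, hy, hxy⟩
    rw [vertexKind_eq hx, vertexKind_eq hy]
    have hx1 := mt (mem_center_iff hk).2 (notMem_center_of_mk_eq hx)
    have hy1 := mt (mem_center_iff hk).2 (notMem_center_of_mk_eq hy)
    have hmem : y ∈ {y | Commute x y} := hxy
    rcases hi : φ x with i | i
    · rw [setOf_commute_of_map_eq_r hφ hk hi hx1] at hmem
      exact (kind_r i).trans hmem.symm
    · rw [setOf_commute_of_map_eq_sr hφ hk hi] at hmem
      rcases hmem with hmem | hmem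
      · exact absurd hmem hy1
      · rw [Set.mem_singleton_iff.1 hmem]
  · obtain ⟨x, -, hx⟩ := c.2
    obtain ⟨y, -, hy⟩ := d.2
    rw [vertexKind_eq hx, vertexKind_eq hy] at h
    rcases hi : φ x with i | i <;> rcases hj : φ y with j | j
    · exact ⟨x, y, hx, hy, commute_of_map_eq_r hφ hk hi hj⟩
    · rw [hi, hj] at h; exact absurd h.symm (kind_sr_ne_zero j)
    · rw [hi, hj] at h; exact absurd h (kind_sr_ne_zero i)
    · rw [hi, hj] at h
      obtain ⟨g', hg⟩ := exists_conj_sr_of_kind_eq h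
      obtain ⟨g, rfl⟩ := hφ g'
      refine ⟨x, g * y * g⁻¹, hx, ?_, commute_of_map_eq hk ?_⟩
      · rw [← hy, ConjClasses.mk_eq_mk_iff_isConj]
        exact (isConj_iff.2 ⟨g, rfl⟩).symm
      · rw [map_mul, map_mul, map_inv, hj, hg, hi]

theorem ncard_carrier_mul_ncard_commute (x : G) :
    (ConjClasses.mk x).carrier.ncard * {y | Commute x y}.ncard = Nat.card G := by
  have h1 := MulAction.index_stabilizer (ConjAct G) x
  have h2 := (MulAction.stabilizer (ConjAct G) x).index_mul_card
  rw [ConjAct.orbit_eq_carrier_conjClasses] at h1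
  rw [h1, ← Subgroup.nat_card_centralizer_nat_card_stabilizer] at h2
  have h3 : {y | Commute x y} = (Subgroup.centralizer {x} : Set G) := by
    ext y
    simp [Subgroup.mem_centralizer_singleton_iff, Commute, SemiconjBy, eq_comm]
  rw [h3, ← Nat.card_coe_set_eq (Subgroup.centralizer {x} : Set G)]
  exact h2

theorem ncard_preimage (hφ : Function.Surjective φ) (hk : φ.ker = Subgroup.center G)
    (s : Set (DihedralGroup n)) :
    (φ ⁻¹' s).ncard = Nat.card (Subgroup.center G) * s.ncard := by
  let e := QuotientGroup.quotientKerEquivOfSurjective φ hφ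
  have h := QuotientGroup.card_preimage_mk φ.ker (e ⁻¹' s)
  have h1 : (QuotientGroup.mk : G → G ⧸ φ.ker) ⁻¹' (e ⁻¹' s) = φ ⁻¹' s := rfl
  rw [h1, Nat.card_coe_set_eq, Nat.card_coe_set_eq,
    Set.ncard_preimage_of_injective_subset_range e.injective (by simp [e.surjective.range_eq])] at h
  rw [h, hk]

theorem natCard_eq (hφ : Function.Surjective φ) (hk : φ.ker = Subgroup.center G) :
    Nat.card G = Nat.card (Subgroup.center G) * (2 * n) := by
  have := ncard_preimage hφ hk Set.univ
  rwa [Set.preimage_univ, Set.ncard_univ, Set.ncard_univ, DihedralGroup.nat_card] at this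

-- Double count: the elements over non-identity images of kind k split into the classes of that
-- kind, each of size s.
open scoped Classical in
theorem fiberCard_vertexKind_mul [Finite G] (hφ : Function.Surjective φ)
    (hk : φ.ker = Subgroup.center G) {k : Fin 3} {s : ℕ}
    (hs : ∀ x, φ x ≠ 1 → kind (φ x) = k → (ConjClasses.mk x).carrier.ncard = s) :
    SimpleGraph.fiberCard (vertexKind φ) k * s =
      Nat.card (Subgroup.center G) * {d : DihedralGroup n | d ≠ 1 ∧ kind d = k}.ncard := by
  have := Fintype.ofFinite G
  rw [← ncard_preimage hφ hk]
  let A : Finset G := Finset.univ.filter fun x => φ x ≠ 1 ∧ kind (φ x) = k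
  let t : Finset (ConjClasses G) :=
    (Finset.univ.filter fun v : Vertex G => vertexKind φ v = k).map ⟨_, Subtype.val_injective⟩
  have hA : φ ⁻¹' {d : DihedralGroup n | d ≠ 1 ∧ kind d = k} = (A : Set G) := by
    ext x; simp [A]
  have hmaps : Set.MapsTo ConjClasses.mk (A : Set G) (t : Set (ConjClasses G)) := by
    intro x hx
    simp only [A, Finset.coe_filter, Finset.mem_univ, true_and, Set.mem_ofPred_eq] at hx
    simp only [t, Finset.coe_map, Set.mem_image, Finset.mem_coe, Finset.mem_filter,
      Finset.mem_univ, true_and]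
    exact ⟨⟨_, x, mt (mem_center_iff hk).1 hx.1, rfl⟩, (vertexKind_eq rfl).trans hx.2, rfl⟩
  rw [hA, Set.ncard_coe_finset, Finset.card_eq_sum_card_fiberwise hmaps,
    Finset.sum_congr rfl (g := fun _ => s), Finset.sum_const, smul_eq_mul, Finset.card_map,
    SimpleGraph.fiberCard, Nat.card_eq_fintype_card, Fintype.card_subtype]
  intro c hc
  obtain ⟨v, hv, rfl⟩ := Finset.mem_map.1 hc
  obtain ⟨x, hx, hxv⟩ := v.2
  have hvk : vertexKind φ v = k := (Finset.mem_filter.1 hv).2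
  rw [← hs x (mt (mem_center_iff hk).2 hx) ((vertexKind_eq hxv).symm.trans hvk),
    ← Set.ncard_coe_finset]
  congr 1
  ext y
  simp only [A, Finset.coe_filter, Finset.mem_filter, Finset.mem_univ, true_and,
    Set.mem_ofPred_eq, ConjClasses.mem_carrier_iff_mk_eq, Function.Embedding.coeFn_mk, hxv]
  exact and_iff_right_of_imp fun hy => ⟨mt (mem_center_iff hk).2 (notMem_center_of_mk_eq hy),
    (vertexKind_eq hy).symm.trans hvk⟩

theorem ncard_carrier_of_kind_eq_zero [Finite G] [NeZero n] (hφ : Function.Surjective φ)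
    (hk : φ.ker = Subgroup.center G) (x : G) (hx1 : φ x ≠ 1) (hx : kind (φ x) = 0) :
    (ConjClasses.mk x).carrier.ncard = 2 := by
  have h := ncard_carrier_mul_ncard_commute x
  rcases hi : φ x with i | i
  · rw [setOf_commute_of_map_eq_r hφ hk hi hx1, ncard_preimage hφ hk, natCard_eq hφ hk,
      ncard_kind_eq_zero] at h
    have hpos : 0 < Nat.card (Subgroup.center G) * n := Nat.mul_pos Nat.card_pos (NeZero.pos n)
    exact Nat.eq_of_mul_eq_mul_right hpos (h.trans (by ring))
  · rw [hi] at hx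
    exact absurd hx (kind_sr_ne_zero i)

theorem ncard_carrier_of_kind_ne_zero [Finite G] (hφ : Function.Surjective φ)
    (hk : φ.ker = Subgroup.center G) (x : G) (hx : kind (φ x) ≠ 0) :
    (ConjClasses.mk x).carrier.ncard = n := by
  have h := ncard_carrier_mul_ncard_commute x
  rcases hi : φ x with i | i
  · rw [hi] at hx
    exact absurd (kind_r i) hx
  · rw [setOf_commute_of_map_eq_sr hφ hk hi, ncard_preimage hφ hk, natCard_eq hφ hk,
      ncard_pair_one_sr] at h
    have hpos : 0 < Nat.card (Subgroup.center G) * 2 := Nat.mul_pos Nat.card_pos two_pos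
    exact Nat.eq_of_mul_eq_mul_right hpos (h.trans (by ring))

section fibers

variable [Finite G]

theorem fiberCard_zero [NeZero n] (hφ : Function.Surjective φ) (hk : φ.ker = Subgroup.center G) :
    SimpleGraph.fiberCard (vertexKind φ) 0 * 2 = Nat.card (Subgroup.center G) * (n - 1) := by
  rw [fiberCard_vertexKind_mul hφ hk (ncard_carrier_of_kind_eq_zero hφ hk),
    ncard_ne_one_kind_eq_zero]

theorem fiberCard_one (hφ : Function.Surjective φ) (hk : φ.ker = Subgroup.center G) :
    SimpleGraph.fiberCard (vertexKind φ) 1 * n =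
      Nat.card (Subgroup.center G) * {i : ZMod n | Even i}.ncard := by
  rw [fiberCard_vertexKind_mul hφ hk fun x _ hx =>
    ncard_carrier_of_kind_ne_zero hφ hk x (by rw [hx]; decide), ncard_kind_eq_one]

theorem fiberCard_two (hφ : Function.Surjective φ) (hk : φ.ker = Subgroup.center G) :
    SimpleGraph.fiberCard (vertexKind φ) 2 * n =
      Nat.card (Subgroup.center G) * {i : ZMod n | ¬ Even i}.ncard := by
  rw [fiberCard_vertexKind_mul hφ hk fun x _ hx =>
    ncard_carrier_of_kind_ne_zero hφ hk x (by rw [hx]; decide), ncard_kind_eq_two]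

theorem fiberCard_one_of_odd [NeZero n] (hφ : Function.Surjective φ) (hk : φ.ker = Subgroup.center G)
    (hn : Odd n) :
    SimpleGraph.fiberCard (vertexKind φ) 1 = Nat.card (Subgroup.center G) := by
  have h := fiberCard_one hφ hk
  rw [ncard_even_zmod_of_odd hn] at h
  exact Nat.eq_of_mul_eq_mul_right (NeZero.pos n) h

theorem fiberCard_two_of_odd [NeZero n] (hφ : Function.Surjective φ) (hk : φ.ker = Subgroup.center G)
    (hn : Odd n) : SimpleGraph.fiberCard (vertexKind φ) 2 = 0 := by
  have h := fiberCard_two hφ hk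
  rw [ncard_not_even_zmod_of_odd hn, mul_zero] at h
  exact (Nat.mul_eq_zero.1 h).resolve_right (NeZero.ne n)

theorem two_mul_fiberCard_one_of_even [NeZero n] (hφ : Function.Surjective φ)
    (hk : φ.ker = Subgroup.center G) (hn : Even n) :
    2 * SimpleGraph.fiberCard (vertexKind φ) 1 = Nat.card (Subgroup.center G) := by
  refine Nat.eq_of_mul_eq_mul_right (NeZero.pos n) ?_
  have h := two_mul_ncard_even_zmod_of_even hn
  rw [mul_assoc, fiberCard_one hφ hk, mul_left_comm, h]

theorem fiberCard_two_of_even [NeZero n] (hφ : Function.Surjective φ) (hk : φ.ker = Subgroup.center G)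
    (hn : Even n) :
    SimpleGraph.fiberCard (vertexKind φ) 2 = SimpleGraph.fiberCard (vertexKind φ) 1 := by
  refine Nat.eq_of_mul_eq_mul_right (NeZero.pos n) ?_
  rw [fiberCard_two hφ hk, fiberCard_one hφ hk, ncard_not_even_zmod_of_even hn]

end fibers

end CCC

end

/-! ### Signs of eigenvalues minus Δ, and the excess polynomials -/

noncomputable section

namespace SimpleGraph

/-- The average row sum for a complete component on `t * b` vertices together with `r` complete
components on `b` vertices. -/
def cliqueDelta (t b r : ℕ) : ℝ :=
  ((t * b : ℝ) * ((t * b - 1) * (t * b - 2)) + r * (b * ((b - 1) * (b - 2)))) / (t * b + r * b)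

/-- Half of the order times the difference between the CNL-energy of a complete graph on `t * b`
vertices together with `r` complete graphs on `b` vertices, and the energy of the complete graph. -/
def cnlExcess (t b r : ℝ) : ℝ :=
  (t * b - 1) * (t * b * (t * b - 2) * (r * b + 1) - r * (b * ((b - 1) * (b - 2)))) -
    (t * b + r * b) * (t * b + r * b - 1) * (t * b + r * b - 2)

/-- The analogue of `cnlExcess` for the CNSL-energy, provided that `(t * b - 2) ^ 2` is at least
the average row sum. -/
def cnslExcess (t b r : ℝ) : ℝ :=
  t * b * (r * b * ((t * b - 1) * (t * b - 2)) - r * (b * ((b - 1) * (b - 2)))) -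
    (t * b + r * b) * (t * b + r * b - 1) * (t * b + r * b - 2)

theorem sub_one_mul_sub_two_nonneg (m : ℕ) : (0 : ℝ) ≤ (m - 1) * (m - 2) := by
  rcases m with _ | _ | m <;> push_cast
  · norm_num
  · norm_num
  · ring_nf; positivity

theorem cliqueDelta_nonneg (t b r : ℕ) : 0 ≤ cliqueDelta t b r := by
  have h1 := sub_one_mul_sub_two_nonneg (t * b)
  have h2 := sub_one_mul_sub_two_nonneg b
  push_cast at h1
  unfold cliqueDelta
  positivity

section signs

variable {t b r : ℕ}

theorem mul_cliqueDelta (ht : 2 ≤ t) (hb : 1 ≤ b) :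
    (t * b + r * b : ℝ) * cliqueDelta t b r =
      (t * b : ℝ) * ((t * b - 1) * (t * b - 2)) + r * (b * ((b - 1) * (b - 2))) := by
  have : (t * b + r * b : ℝ) ≠ 0 := by positivity
  rw [cliqueDelta, mul_div_cancel₀ _ this]

theorem cliqueDelta_le_of (ht : 2 ≤ t) (hb : 1 ≤ b) {x : ℝ}
    (h : (t * b : ℝ) * ((t * b - 1) * (t * b - 2)) + r * (b * ((b - 1) * (b - 2))) ≤
      x * (t * b + r * b)) : cliqueDelta t b r ≤ x := by
  have : (0 : ℝ) < t * b + r * b := by positivity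
  rwa [cliqueDelta, div_le_iff₀ this]

theorem le_cliqueDelta_of (ht : 2 ≤ t) (hb : 1 ≤ b) {x : ℝ}
    (h : x * (t * b + r * b) ≤
      (t * b : ℝ) * ((t * b - 1) * (t * b - 2)) + r * (b * ((b - 1) * (b - 2)))) :
    x ≤ cliqueDelta t b r := by
  have : (0 : ℝ) < t * b + r * b := by positivity
  rwa [cliqueDelta, le_div_iff₀ this]

theorem cliqueDelta_le_laplacian (ht : 2 ≤ t) (hb : 1 ≤ b) (hr : r = 1 ∨ r = 2) :
    cliqueDelta t b r ≤ t * b * (t * b - 2) := by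
  refine cliqueDelta_le_of ht hb ?_
  rw [← sub_nonneg]
  -- Shifting the variables to start at their lower bounds leaves a polynomial with nonnegative
  -- coefficients; the inequalities below use the same device.
  obtain ⟨t, rfl⟩ := Nat.exists_eq_add_of_le ht
  rcases eq_or_lt_of_le hb with rfl | hb2
  · rcases hr with rfl | rfl <;> push_cast <;> ring_nf <;> positivity
  · obtain ⟨b, rfl⟩ := Nat.exists_eq_add_of_lt hb2
    rcases hr with rfl | rfl <;> push_cast <;> ring_nf <;> positivity

theorem mul_abs_sub_cliqueDelta (ht : 2 ≤ t) (hb : 1 ≤ b) (hr : r = 1 ∨ r = 2) :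
    ((b : ℝ) - 1) * |b * (b - 2) - cliqueDelta t b r| =
      (b - 1) * (cliqueDelta t b r - b * (b - 2)) := by
  rcases eq_or_lt_of_le hb with rfl | hb2
  · simp
  · congr 1
    rw [abs_sub_comm, abs_of_nonneg]
    rw [sub_nonneg]
    refine le_cliqueDelta_of ht hb ?_
    rw [← sub_nonneg]
    obtain ⟨t, rfl⟩ := Nat.exists_eq_add_of_le ht
    obtain ⟨b, rfl⟩ := Nat.exists_eq_add_of_lt hb2
    rcases hr with rfl | rfl <;> push_cast <;> ring_nf <;> positivity

/-- The factor b - 1 is the multiplicity. It is needed: at b = 1 the sign can be wrong (t = 2 gives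
Δ = 0 < 1), but then the eigenvalue does not occur. -/
theorem mul_abs_sq_sub_cliqueDelta (ht : 2 ≤ t) (hb : 1 ≤ b) (hr : r = 1 ∨ r = 2) :
    ((b : ℝ) - 1) * |(b - 2) * (b - 2) - cliqueDelta t b r| =
      (b - 1) * (cliqueDelta t b r - (b - 2) * (b - 2)) := by
  rcases eq_or_lt_of_le hb with rfl | hb2
  · simp
  · congr 1
    rw [abs_sub_comm, abs_of_nonneg]
    rw [sub_nonneg]
    refine le_cliqueDelta_of ht hb ?_
    rw [← sub_nonneg]
    obtain ⟨t, rfl⟩ := Nat.exists_eq_add_of_le ht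
    obtain ⟨b, rfl⟩ := Nat.exists_eq_add_of_lt hb2
    rcases hr with rfl | rfl <;> push_cast <;> ring_nf <;> positivity

theorem two_mul_le_cliqueDelta (ht : 2 ≤ t) (hb : 1 ≤ b) (hr : r = 1 ∨ r = 2) :
    (2 : ℝ) * (b - 1) * (b - 2) ≤ cliqueDelta t b r := by
  refine le_cliqueDelta_of ht hb ?_
  rw [← sub_nonneg]
  obtain ⟨t, rfl⟩ := Nat.exists_eq_add_of_le ht
  obtain ⟨b, rfl⟩ := Nat.exists_eq_add_of_le hb
  rcases hr with rfl | rfl <;> push_cast <;> ring_nf <;> positivity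

theorem cliqueDelta_le_two_mul (ht : 2 ≤ t) (hb : 1 ≤ b) (hr : r = 1 ∨ r = 2) :
    cliqueDelta t b r ≤ 2 * (t * b - 1) * (t * b - 2) := by
  refine cliqueDelta_le_of ht hb ?_
  rw [← sub_nonneg]
  obtain ⟨t, rfl⟩ := Nat.exists_eq_add_of_le ht
  obtain ⟨b, rfl⟩ := Nat.exists_eq_add_of_le hb
  rcases hr with rfl | rfl <;> push_cast <;> ring_nf <;> positivity

/-- At b = 1 the difference times t + r is -2(t-2) for r = 1 and (t-2)(t-4) for r = 2, which
explains the extra hypothesis. -/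
theorem cliqueDelta_le_sq (ht : 2 ≤ t) (hb : 1 ≤ b) (hr : r = 1 ∨ r = 2)
    (h : 2 ≤ b ∨ r = 2 ∧ 4 ≤ t) :
    cliqueDelta t b r ≤ (t * b - 2) * (t * b - 2) := by
  refine cliqueDelta_le_of ht hb ?_
  rw [← sub_nonneg]
  rcases h with h | ⟨rfl, h⟩
  · obtain ⟨t, rfl⟩ := Nat.exists_eq_add_of_le ht
    obtain ⟨b, rfl⟩ := Nat.exists_eq_add_of_le h
    rcases hr with rfl | rfl <;> push_cast <;> ring_nf <;> positivity
  · obtain ⟨t, rfl⟩ := Nat.exists_eq_add_of_le h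
    obtain ⟨b, rfl⟩ := Nat.exists_eq_add_of_le hb
    push_cast; ring_nf; positivity

theorem mul_cnlEnergy_sub (ht : 2 ≤ t) (hb : 1 ≤ b) (hr : r = 1 ∨ r = 2) :
    (t * b + r * b : ℝ) * (cliqueEnergy (-1) (cliqueDelta t b r) (t * b) +
      r * cliqueEnergy (-1) (cliqueDelta t b r) b -
      2 * ((t * b + r * b : ℝ) - 1) * ((t * b + r * b : ℝ) - 2)) = 2 * cnlExcess t b r := by
  have h0 := cliqueDelta_nonneg t b r
  have h1 := cliqueDelta_le_laplacian ht hb hr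
  have h2 := mul_abs_sub_cliqueDelta ht hb hr
  have hD := mul_cliqueDelta (r := r) ht hb
  rw [cliqueEnergy, cliqueEnergy, if_neg (by positivity), if_neg (by positivity)]
  push_cast
  set D := cliqueDelta t b r
  have e1 : (1 + -1 : ℝ) = 0 := by norm_num
  simp only [e1, zero_mul, zero_sub, abs_neg, abs_of_nonneg h0, sub_neg_eq_add, sub_add_cancel]
  rw [h2, abs_of_nonneg (sub_nonneg.2 h1), cnlExcess]
  -- The factor is the net coefficient of Δ in the energy once the absolute values are opened.
  linear_combination (2 - t * b + r * b) * hD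

theorem mul_cnslEnergy_sub (ht : 2 ≤ t) (hb : 1 ≤ b) (hr : r = 1 ∨ r = 2)
    (h : 2 ≤ b ∨ r = 2 ∧ 4 ≤ t) :
    (t * b + r * b : ℝ) * (cliqueEnergy 1 (cliqueDelta t b r) (t * b) +
      r * cliqueEnergy 1 (cliqueDelta t b r) b -
      2 * ((t * b + r * b : ℝ) - 1) * ((t * b + r * b : ℝ) - 2)) = 2 * cnslExcess t b r := by
  have h1 := cliqueDelta_le_two_mul ht hb hr
  have h2 := cliqueDelta_le_sq ht hb hr h
  have h3 := two_mul_le_cliqueDelta ht hb hr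
  have h4 := mul_abs_sq_sub_cliqueDelta ht hb hr
  have hD := mul_cliqueDelta (r := r) ht hb
  rw [cliqueEnergy, cliqueEnergy, if_neg (by positivity), if_neg (by positivity)]
  push_cast
  set D := cliqueDelta t b r
  have e1 (x : ℝ) : x - 1 - 1 = x - 2 := by ring
  rw [one_add_one_eq_two, e1, e1, h4, abs_of_nonneg (sub_nonneg.2 h1),
    abs_of_nonneg (sub_nonneg.2 h2), abs_of_nonpos (sub_nonpos.2 h3), cnslExcess]
  linear_combination (r * b - t * b) * hD

theorem sq_le_cliqueDelta_one (ht : 2 ≤ t) :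
    ((t : ℝ) - 2) * (t - 2) ≤ cliqueDelta t 1 1 := by
  refine le_cliqueDelta_of ht le_rfl ?_
  rw [← sub_nonneg]
  obtain ⟨t, rfl⟩ := Nat.exists_eq_add_of_le ht
  push_cast; ring_nf; positivity

/-- Here Δ is at least (t-2)^2, so that sign flips; after multiplication by t + 1 the gap is exactly
2(t-1)(t+4). -/
theorem cnslEnergy_lt_of_isolated (ht : 2 ≤ t) :
    cliqueEnergy 1 (cliqueDelta t 1 1) t + cliqueEnergy 1 (cliqueDelta t 1 1) 1 <
      2 * ((t + 1 : ℝ) - 1) * ((t + 1 : ℝ) - 2) := by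
  have h0 := cliqueDelta_nonneg t 1 1
  have h1 := cliqueDelta_le_two_mul (t := t) (b := 1) (r := 1) ht le_rfl (Or.inl rfl)
  have h2 := sq_le_cliqueDelta_one ht
  have hD := mul_cliqueDelta (t := t) (b := 1) (r := 1) ht le_rfl
  rw [cliqueEnergy, cliqueEnergy, if_neg (by positivity), if_neg (by positivity)]
  set D := cliqueDelta t 1 1
  push_cast at *
  have e1 (x : ℝ) : x - 1 - 1 = x - 2 := by ring
  simp only [mul_one, one_mul] at h1 hD
  rw [one_add_one_eq_two, e1, abs_of_nonneg (sub_nonneg.2 h1), abs_of_nonpos (sub_nonpos.2 h2)]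
  simp only [sub_self, mul_zero, zero_mul, zero_sub, abs_neg, abs_of_nonneg h0]
  have ht' : (2 : ℝ) ≤ t := by exact_mod_cast ht
  have hpos : (0 : ℝ) < t + 1 := by positivity
  refine lt_of_mul_lt_mul_left ?_ hpos.le
  have hfin : (0 : ℝ) < 2 * (t - 1) * (t + 4) := by
    have : (0 : ℝ) < t - 1 := by linarith
    positivity
  linear_combination (t - 1) * hD + hfin

theorem cnslEnergy_lt_of_three_one_one :
    cliqueEnergy 1 (cliqueDelta 3 1 2) 3 + 2 * cliqueEnergy 1 (cliqueDelta 3 1 2) 1 < 24 := by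
  norm_num [cliqueEnergy, cliqueDelta, abs_of_nonneg, abs_of_nonpos]

/-- With equal cliques every row sum is Δ = (b-1)(b-2), so the Laplacian and signless energies
coincide. -/
theorem cliqueEnergy_eq_of_two_cliques {ε : ℝ} (hε : ε = -1 ∨ ε = 1) (hb : 1 ≤ b) :
    cliqueEnergy ε (cliqueDelta 1 b 1) b + cliqueEnergy ε (cliqueDelta 1 b 1) b =
      4 * (b - 1) * (b - 2) := by
  have hD : cliqueDelta 1 b 1 = (b - 1) * (b - 2) := by
    have : (b : ℝ) ≠ 0 := by positivity
    rw [cliqueDelta]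
    field_simp
    push_cast
    ring
  rw [hD, cliqueEnergy, if_neg (by positivity)]
  rcases eq_or_lt_of_le hb with rfl | hb2
  · norm_num
  · have h1 : (2 : ℝ) ≤ b := by exact_mod_cast hb2
    have h2 : (0 : ℝ) ≤ (b - 1) * (b - 2) := sub_one_mul_sub_two_nonneg b
    rcases hε with rfl | rfl
    · have e1 : (1 + -1) * ((b : ℝ) - 1) * (b - 2) - (b - 1) * (b - 2) =
        -((b - 1) * (b - 2)) := by ring
      have e2 : ((b : ℝ) - 1 - -1) * (b - 2) - (b - 1) * (b - 2) = b - 2 := by ring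
      rw [e1, e2, abs_neg, abs_of_nonneg h2, abs_of_nonneg (by linarith)]
      ring
    · have e1 : (1 + 1) * ((b : ℝ) - 1) * (b - 2) - (b - 1) * (b - 2) =
        (b - 1) * (b - 2) := by ring
      have e2 : ((b : ℝ) - 1 - 1) * (b - 2) - (b - 1) * (b - 2) = -(b - 2) := by ring
      rw [e1, e2, abs_neg, abs_of_nonneg h2, abs_of_nonneg (by linarith)]
      ring

end signs

section excess

variable {t b : ℕ}

/-- The range is cut into the edge of least b, the edge of least t and the interior; on each, the
shifted polynomial has nonnegative coefficients and a positive constant term. The three companion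
lemmas work the same way. -/
theorem cnlExcess_one_pos (ht : 2 ≤ t) (hb : 1 ≤ b) (h1 : b = 1 → 6 ≤ t)
    (h2 : t = 2 → 4 ≤ b) : 0 < cnlExcess t b 1 := by
  unfold cnlExcess
  rcases eq_or_lt_of_le hb with rfl | hb
  · obtain ⟨t, rfl⟩ := Nat.exists_eq_add_of_le (h1 rfl)
    push_cast; ring_nf; positivity
  rcases eq_or_lt_of_le ht with rfl | ht
  · obtain ⟨b, rfl⟩ := Nat.exists_eq_add_of_le (h2 rfl)
    push_cast; ring_nf; positivity
  · obtain ⟨t, rfl⟩ := Nat.exists_eq_add_of_lt ht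
    obtain ⟨b, rfl⟩ := Nat.exists_eq_add_of_lt hb
    push_cast; ring_nf; positivity

theorem cnlExcess_two_pos (ht : 3 ≤ t) (hb : 1 ≤ b) (h1 : b = 1 → 7 ≤ t)
    (h2 : t = 3 → 3 ≤ b) : 0 < cnlExcess t b 2 := by
  unfold cnlExcess
  rcases eq_or_lt_of_le hb with rfl | hb
  · obtain ⟨t, rfl⟩ := Nat.exists_eq_add_of_le (h1 rfl)
    push_cast; ring_nf; positivity
  rcases eq_or_lt_of_le ht with rfl | ht
  · obtain ⟨b, rfl⟩ := Nat.exists_eq_add_of_le (h2 rfl)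
    push_cast; ring_nf; positivity
  · obtain ⟨t, rfl⟩ := Nat.exists_eq_add_of_lt ht
    obtain ⟨b, rfl⟩ := Nat.exists_eq_add_of_lt hb
    push_cast; ring_nf; positivity

theorem cnslExcess_one_pos (ht : 2 ≤ t) (hb : 2 ≤ b) (h1 : b = 2 → 5 ≤ t)
    (h2 : t = 2 → 5 ≤ b) : 0 < cnslExcess t b 1 := by
  unfold cnslExcess
  rcases eq_or_lt_of_le hb with rfl | hb
  · obtain ⟨t, rfl⟩ := Nat.exists_eq_add_of_le (h1 rfl)
    push_cast; ring_nf; positivity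
  rcases eq_or_lt_of_le ht with rfl | ht
  · obtain ⟨b, rfl⟩ := Nat.exists_eq_add_of_le (h2 rfl)
    push_cast; ring_nf; positivity
  · obtain ⟨t, rfl⟩ := Nat.exists_eq_add_of_lt ht
    obtain ⟨b, rfl⟩ := Nat.exists_eq_add_of_lt hb
    push_cast; ring_nf; positivity

theorem cnslExcess_two_pos (ht : 3 ≤ t) (hb : 1 ≤ b) (h1 : b = 1 → 9 ≤ t)
    (h2 : t = 3 → 3 ≤ b) : 0 < cnslExcess t b 2 := by
  unfold cnslExcess
  rcases eq_or_lt_of_le hb with rfl | hb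
  · obtain ⟨t, rfl⟩ := Nat.exists_eq_add_of_le (h1 rfl)
    push_cast; ring_nf; positivity
  rcases eq_or_lt_of_le ht with rfl | ht
  · obtain ⟨b, rfl⟩ := Nat.exists_eq_add_of_le (h2 rfl)
    push_cast; ring_nf; positivity
  · obtain ⟨t, rfl⟩ := Nat.exists_eq_add_of_lt ht
    obtain ⟨b, rfl⟩ := Nat.exists_eq_add_of_lt hb
    push_cast; ring_nf; positivity

theorem cnlExcess_one_eq_zero (ht : t = 5) (hb : b = 1) : cnlExcess t b 1 = 0 := by
  norm_num [cnlExcess, ht, hb]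

theorem cnlExcess_one_neg (h : (b = 1 ∧ (t = 2 ∨ t = 3 ∨ t = 4)) ∨ t = 2 ∧ (b = 2 ∨ b = 3)) :
    cnlExcess t b 1 < 0 := by
  rcases h with ⟨rfl, rfl | rfl | rfl⟩ | ⟨rfl, rfl | rfl⟩ <;> norm_num [cnlExcess]

theorem cnlExcess_two_neg (h : (b = 1 ∧ (t = 3 ∨ t = 5)) ∨ t = 3 ∧ b = 2) :
    cnlExcess t b 2 < 0 := by
  rcases h with ⟨rfl, rfl | rfl⟩ | ⟨rfl, rfl⟩ <;> norm_num [cnlExcess]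

theorem cnslExcess_one_neg (h : (b = 2 ∧ (t = 2 ∨ t = 3 ∨ t = 4)) ∨ t = 2 ∧ (b = 3 ∨ b = 4)) :
    cnslExcess t b 1 < 0 := by
  rcases h with ⟨rfl, rfl | rfl | rfl⟩ | ⟨rfl, rfl | rfl⟩ <;> norm_num [cnslExcess]

theorem cnslExcess_two_neg (h : (b = 1 ∧ (t = 5 ∨ t = 7)) ∨ t = 3 ∧ b = 2) :
    cnslExcess t b 2 < 0 := by
  rcases h with ⟨rfl, rfl | rfl⟩ | ⟨rfl, rfl⟩ <;> norm_num [cnslExcess]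

end excess

/-! ### From clique sizes to the energetic properties -/

section labelling

variable {V : Type*} {f : V → Fin 3} {t b r : ℕ}

theorem sum_cliqueEnergy_of_fiberCard (ε Δ : ℝ) (h0 : fiberCard f 0 = t * b)
    (h1 : fiberCard f 1 = b) (h2 : r = 1 ∧ fiberCard f 2 = 0 ∨ r = 2 ∧ fiberCard f 2 = b) :
    ∑ i, cliqueEnergy ε Δ (fiberCard f i) = cliqueEnergy ε Δ (t * b) + r * cliqueEnergy ε Δ b := by
  have hz : cliqueEnergy ε Δ 0 = 0 := if_pos rfl
  rw [Fin.sum_univ_three, h0, h1]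
  rcases h2 with ⟨rfl, h2⟩ | ⟨rfl, h2⟩ <;> rw [h2] <;> push_cast
  · rw [hz]; ring
  · ring

variable [Fintype V] {Γ : SimpleGraph V}

theorem card_eq_of_fiberCard (h0 : fiberCard f 0 = t * b) (h1 : fiberCard f 1 = b)
    (h2 : r = 1 ∧ fiberCard f 2 = 0 ∨ r = 2 ∧ fiberCard f 2 = b) :
    (Fintype.card V : ℝ) = t * b + r * b := by
  rw [card_eq_sum_fiberCard f, Fin.sum_univ_three, h0, h1]
  rcases h2 with ⟨rfl, h2⟩ | ⟨rfl, h2⟩ <;> rw [h2] <;> push_cast <;> ring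

theorem cnDelta_eq_of_fiberCard (h : ∀ v w, Γ.Adj v w ↔ v ≠ w ∧ f v = f w)
    (h0 : fiberCard f 0 = t * b) (h1 : fiberCard f 1 = b)
    (h2 : r = 1 ∧ fiberCard f 2 = 0 ∨ r = 2 ∧ fiberCard f 2 = b) :
    Γ.cnDelta = cliqueDelta t b r := by
  rw [cnDelta_of_adj_iff h, cliqueDelta, Fin.sum_univ_three, Fin.sum_univ_three, h0, h1]
  rcases h2 with ⟨rfl, h2⟩ | ⟨rfl, h2⟩ <;> rw [h2] <;> push_cast <;> congr 1 <;> ring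

theorem cnlEnergy_eq_of_fiberCard (h : ∀ v w, Γ.Adj v w ↔ v ≠ w ∧ f v = f w)
    (h0 : fiberCard f 0 = t * b) (h1 : fiberCard f 1 = b)
    (h2 : r = 1 ∧ fiberCard f 2 = 0 ∨ r = 2 ∧ fiberCard f 2 = b) :
    Γ.cnlEnergy = cliqueEnergy (-1) (cliqueDelta t b r) (t * b) +
      r * cliqueEnergy (-1) (cliqueDelta t b r) b := by
  rw [cnlEnergy_of_adj_iff h, cnDelta_eq_of_fiberCard h h0 h1 h2,
    sum_cliqueEnergy_of_fiberCard _ _ h0 h1 h2]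

theorem cnslEnergy_eq_of_fiberCard (h : ∀ v w, Γ.Adj v w ↔ v ≠ w ∧ f v = f w)
    (h0 : fiberCard f 0 = t * b) (h1 : fiberCard f 1 = b)
    (h2 : r = 1 ∧ fiberCard f 2 = 0 ∨ r = 2 ∧ fiberCard f 2 = b) :
    Γ.cnslEnergy = cliqueEnergy 1 (cliqueDelta t b r) (t * b) +
      r * cliqueEnergy 1 (cliqueDelta t b r) b := by
  rw [cnslEnergy_of_adj_iff h, cnDelta_eq_of_fiberCard h h0 h1 h2,
    sum_cliqueEnergy_of_fiberCard _ _ h0 h1 h2]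

theorem eq_iff_and_gt_iff_of_mul_sub_eq {N x y p : ℝ} (hN : 0 < N) (h : N * (x - y) = 2 * p) :
    (x = y ↔ p = 0) ∧ (x > y ↔ 0 < p) := by
  refine ⟨⟨fun hxy => ?_, fun hp => ?_⟩, ⟨fun hxy => ?_, fun hp => ?_⟩⟩
  · rw [hxy, sub_self, mul_zero] at h
    linarith
  · rw [hp, mul_zero] at h
    exact sub_eq_zero.1 ((mul_eq_zero.1 h).resolve_left hN.ne')
  · have := mul_pos hN (sub_pos.2 hxy)
    linarith
  · have : 0 < N * (x - y) := by linarith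
    exact sub_pos.1 (pos_of_mul_pos_right this hN.le)

theorem cnl_energetic_iff (h : ∀ v w, Γ.Adj v w ↔ v ≠ w ∧ f v = f w)
    (h0 : fiberCard f 0 = t * b) (h1 : fiberCard f 1 = b)
    (h2 : r = 1 ∧ fiberCard f 2 = 0 ∨ r = 2 ∧ fiberCard f 2 = b) (ht : 2 ≤ t) (hb : 1 ≤ b) :
    (Γ.CNLBorderenergetic ↔ cnlExcess t b r = 0) ∧ (Γ.CNLHyperenergetic ↔ 0 < cnlExcess t b r) := by
  have hN : (0 : ℝ) < t * b + r * b := by positivity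
  rw [CNLBorderenergetic, CNLHyperenergetic, card_eq_of_fiberCard h0 h1 h2,
    cnlEnergy_eq_of_fiberCard h h0 h1 h2]
  exact eq_iff_and_gt_iff_of_mul_sub_eq hN
    (mul_cnlEnergy_sub ht hb (h2.imp And.left And.left))

theorem cnsl_energetic_iff (h : ∀ v w, Γ.Adj v w ↔ v ≠ w ∧ f v = f w)
    (h0 : fiberCard f 0 = t * b) (h1 : fiberCard f 1 = b)
    (h2 : r = 1 ∧ fiberCard f 2 = 0 ∨ r = 2 ∧ fiberCard f 2 = b) (ht : 2 ≤ t) (hb : 1 ≤ b)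
    (h3 : 2 ≤ b ∨ r = 2 ∧ 4 ≤ t) :
    (Γ.CNSLBorderenergetic ↔ cnslExcess t b r = 0) ∧
      (Γ.CNSLHyperenergetic ↔ 0 < cnslExcess t b r) := by
  have hN : (0 : ℝ) < t * b + r * b := by positivity
  rw [CNSLBorderenergetic, CNSLHyperenergetic, card_eq_of_fiberCard h0 h1 h2,
    cnslEnergy_eq_of_fiberCard h h0 h1 h2]
  exact eq_iff_and_gt_iff_of_mul_sub_eq hN
    (mul_cnslEnergy_sub ht hb (h2.imp And.left And.left) h3)

theorem not_cnsl_energetic_of_isolated (h : ∀ v w, Γ.Adj v w ↔ v ≠ w ∧ f v = f w)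
    (h0 : fiberCard f 0 = t) (h1 : fiberCard f 1 = 1) (h2 : fiberCard f 2 = 0) (ht : 2 ≤ t) :
    ¬ Γ.CNSLBorderenergetic ∧ ¬ Γ.CNSLHyperenergetic := by
  have h0' : fiberCard f 0 = t * 1 := by rw [h0, mul_one]
  have hE := cnslEnergy_eq_of_fiberCard h h0' h1 (Or.inl ⟨rfl, h2⟩)
  have hc := card_eq_of_fiberCard h0' h1 (Or.inl ⟨rfl, h2⟩)
  have hlt := cnslEnergy_lt_of_isolated ht
  rw [CNSLBorderenergetic, CNSLHyperenergetic, hE, hc]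
  simp only [mul_one, Nat.cast_one, one_mul]
  exact ⟨hlt.ne, hlt.not_gt⟩

theorem not_cnsl_energetic_of_three_one_one (h : ∀ v w, Γ.Adj v w ↔ v ≠ w ∧ f v = f w)
    (h0 : fiberCard f 0 = 3) (h1 : fiberCard f 1 = 1) (h2 : fiberCard f 2 = 1) :
    ¬ Γ.CNSLBorderenergetic ∧ ¬ Γ.CNSLHyperenergetic := by
  have hE := cnslEnergy_eq_of_fiberCard (t := 3) h h0 h1 (Or.inr ⟨rfl, h2⟩)
  have hc := card_eq_of_fiberCard (t := 3) h0 h1 (Or.inr ⟨rfl, h2⟩)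
  have hlt := cnslEnergy_lt_of_three_one_one
  have hT : 2 * (((3 : ℕ) * (1 : ℕ) + (2 : ℕ) * (1 : ℕ) : ℝ) - 1) *
      (((3 : ℕ) * (1 : ℕ) + (2 : ℕ) * (1 : ℕ) : ℝ) - 2) = 24 := by norm_num
  rw [CNSLBorderenergetic, CNSLHyperenergetic, hE, hc, hT]
  exact ⟨hlt.ne, hlt.not_gt⟩

/-- Compare 4(b-1)(b-2) with 2(2b-1)(2b-2) = 4(b-1)(2b-1): they agree only at b = 1, and otherwise
the energy is smaller. -/
theorem energetic_of_two_cliques (h : ∀ v w, Γ.Adj v w ↔ v ≠ w ∧ f v = f w)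
    (h0 : fiberCard f 0 = b) (h1 : fiberCard f 1 = b) (h2 : fiberCard f 2 = 0) (hb : 1 ≤ b) :
    (Γ.CNLBorderenergetic ↔ b = 1) ∧ ¬ Γ.CNLHyperenergetic ∧
      (Γ.CNSLBorderenergetic ↔ b = 1) ∧ ¬ Γ.CNSLHyperenergetic := by
  have h0' : fiberCard f 0 = 1 * b := by rw [h0, one_mul]
  have hL := cnlEnergy_eq_of_fiberCard h h0' h1 (Or.inl ⟨rfl, h2⟩)
  have hS := cnslEnergy_eq_of_fiberCard h h0' h1 (Or.inl ⟨rfl, h2⟩)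
  have hc := card_eq_of_fiberCard h0' h1 (Or.inl ⟨rfl, h2⟩)
  simp only [one_mul, Nat.cast_one] at hL hS hc
  rw [cliqueEnergy_eq_of_two_cliques (Or.inl rfl) hb] at hL
  rw [cliqueEnergy_eq_of_two_cliques (Or.inr rfl) hb] at hS
  rw [CNLBorderenergetic, CNLHyperenergetic, CNSLBorderenergetic, CNSLHyperenergetic, hL, hS, hc]
  have hb' : (1 : ℝ) ≤ b := by exact_mod_cast hb
  have hle : 4 * ((b : ℝ) - 1) * (b - 2) ≤ 2 * (b + b - 1) * (b + b - 2) := by nlinarith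
  have heq : 4 * ((b : ℝ) - 1) * (b - 2) = 2 * (b + b - 1) * (b + b - 2) ↔ b = 1 := by
    constructor
    · intro hx
      have h3 : (b : ℝ) = 1 := by nlinarith
      exact_mod_cast h3
    · rintro rfl
      norm_num
  exact ⟨heq, hle.not_gt, heq, hle.not_gt⟩

end labelling

end SimpleGraph

end

/-! ### The classification -/

theorem mainTheorem3 {G : Type*} [Group G] [Finite G] (n z : ℕ) (hn : 3 ≤ n)
    (hz : Nat.card (Subgroup.center G) = z)
    (hG : Nonempty (G ⧸ Subgroup.center G ≃* DihedralGroup n)) :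
    ((CCC.graph G).CNLBorderenergetic ↔ (n = 3 ∨ n = 11) ∧ z = 1) ∧
    ((CCC.graph G).CNLHyperenergetic ↔
      ¬ (((n = 3 ∨ n = 11) ∧ z = 1) ∨
        ((n = 4 ∨ n = 6) ∧ z = 2) ∨
        (n = 4 ∧ z = 3) ∨
        (n = 4 ∧ z = 4) ∨
        (n = 3 ∧ 2 ≤ z) ∨
        ((n = 5 ∨ n = 7 ∨ n = 9) ∧ z = 1) ∨
        (n = 5 ∧ (z = 2 ∨ z = 3)))) ∧
    ((CCC.graph G).CNSLBorderenergetic ↔ n = 3 ∧ z = 1) ∧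
    ((CCC.graph G).CNSLHyperenergetic ↔
      ¬ ((n = 3 ∧ z = 1) ∨
        (n = 4 ∧ (z = 2 ∨ z = 3 ∨ z = 4 ∨ z = 5)) ∨
        ((n = 6 ∨ n = 8) ∧ z = 2) ∨
        (n = 6 ∧ z = 3) ∨
        (n = 5 ∧ z = 1) ∨
        (n = 3 ∧ 2 ≤ z) ∨
        (7 ≤ n ∧ Odd n ∧ z = 1) ∨
        ((n = 5 ∨ n = 7 ∨ n = 9) ∧ z = 2) ∨
        (n = 5 ∧ (z = 3 ∨ z = 4)))) := by
  obtain ⟨e⟩ := hG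
  have : NeZero n := ⟨by omega⟩
  let φ : G →* DihedralGroup n := e.toMonoidHom.comp (QuotientGroup.mk' (Subgroup.center G))
  have hφ : Function.Surjective φ := e.surjective.comp (QuotientGroup.mk'_surjective _)
  have hk : φ.ker = Subgroup.center G := by
    ext x
    simp [φ]
  have hadj := CCC.graph_adj_iff hφ hk
  have hz1 : 1 ≤ z := hz ▸ Nat.card_pos
  have h0 := CCC.fiberCard_zero hφ hk
  rcases Nat.even_or_odd n with hpar | hpar
  · have h1 := CCC.two_mul_fiberCard_one_of_even hφ hk hpar
    have h2 := CCC.fiberCard_two_of_even hφ hk hpar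
    rw [hz] at h0 h1
    obtain ⟨b, hb⟩ : ∃ b, SimpleGraph.fiberCard (CCC.vertexKind φ) 1 = b := ⟨_, rfl⟩
    obtain ⟨t, rfl⟩ : ∃ t, n = t + 1 := ⟨n - 1, by omega⟩
    rw [hb] at h1 h2
    subst h1
    have h0' : SimpleGraph.fiberCard (CCC.vertexKind φ) 0 = t * b := by
      rw [Nat.add_sub_cancel] at h0
      linarith
    have hnodd : ¬ Odd (t + 1) := Nat.not_odd_iff_even.2 hpar
    -- Parity matters below: with b = 1 it excludes t = 4, 6, 8, so that beyond the listed
    -- exceptions t is at least 7 (CNL) or 9 (CNSL).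
    have hmod : t % 2 = 1 := by rw [Nat.even_iff] at hpar; omega
    have hb1 : 1 ≤ b := by omega
    obtain ⟨hL1, hL2⟩ := SimpleGraph.cnl_energetic_iff hadj h0' hb (Or.inr ⟨rfl, h2⟩)
      (by omega) hb1
    refine and_assoc.1 ⟨?_, ?_⟩
    · rw [hL1, hL2]
      push_cast
      by_cases hex : (b = 1 ∧ (t = 3 ∨ t = 5)) ∨ t = 3 ∧ b = 2
      · have := SimpleGraph.cnlExcess_two_neg hex
        exact ⟨iff_of_false this.ne (by omega), iff_of_false this.not_gt (by omega)⟩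
      · have := SimpleGraph.cnlExcess_two_pos (t := t) (b := b) (by omega) hb1 (by omega) (by omega)
        exact ⟨iff_of_false this.ne' (by omega), iff_of_true this (by omega)⟩
    · by_cases hsp : t = 3 ∧ b = 1
      · obtain ⟨rfl, rfl⟩ := hsp
        obtain ⟨hS1, hS2⟩ := SimpleGraph.not_cnsl_energetic_of_three_one_one hadj h0' hb h2
        exact ⟨iff_of_false hS1 (by omega), iff_of_false hS2 (by omega)⟩
      obtain ⟨hS1, hS2⟩ := SimpleGraph.cnsl_energetic_iff hadj h0' hb (Or.inr ⟨rfl, h2⟩)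
        (by omega) hb1 (by omega)
      rw [hS1, hS2]
      push_cast
      by_cases hex : (b = 1 ∧ (t = 5 ∨ t = 7)) ∨ t = 3 ∧ b = 2
      · have := SimpleGraph.cnslExcess_two_neg hex
        exact ⟨iff_of_false this.ne (by omega), iff_of_false this.not_gt (by omega)⟩
      · have := SimpleGraph.cnslExcess_two_pos (t := t) (b := b) (by omega) hb1 (by omega)
          (by omega)
        exact ⟨iff_of_false this.ne' (by omega), iff_of_true this (by simp only [hnodd]; omega)⟩
  · have h1 := CCC.fiberCard_one_of_odd hφ hk hpar
    have h2 := CCC.fiberCard_two_of_odd hφ hk hpar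
    rw [hz] at h0 h1
    obtain ⟨t, rfl⟩ := hpar
    have h0' : SimpleGraph.fiberCard (CCC.vertexKind φ) 0 = t * z := by
      rw [Nat.add_sub_cancel] at h0
      linarith
    have hodd : Odd (2 * t + 1) := ⟨t, rfl⟩
    -- The value t = 1 is n = 3, where both cliques have z vertices.
    rcases eq_or_lt_of_le (show 1 ≤ t by omega) with rfl | ht
    · rw [one_mul] at h0'
      obtain ⟨hL1, hL2, hS1, hS2⟩ := SimpleGraph.energetic_of_two_cliques hadj h0' h1 h2 hz1
      rw [hL1, hS1]
      exact ⟨by omega, iff_of_false hL2 (by omega), by omega, iff_of_false hS2 (by omega)⟩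
    obtain ⟨hL1, hL2⟩ := SimpleGraph.cnl_energetic_iff hadj h0' h1 (Or.inl ⟨rfl, h2⟩) ht hz1
    refine and_assoc.1 ⟨?_, ?_⟩
    · rw [hL1, hL2]
      push_cast
      by_cases hbd : t = 5 ∧ z = 1
      · have := SimpleGraph.cnlExcess_one_eq_zero hbd.1 hbd.2
        exact ⟨iff_of_true this (by omega), iff_of_false this.not_gt (by omega)⟩
      by_cases hex : (z = 1 ∧ (t = 2 ∨ t = 3 ∨ t = 4)) ∨ t = 2 ∧ (z = 2 ∨ z = 3)
      · have := SimpleGraph.cnlExcess_one_neg hex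
        exact ⟨iff_of_false this.ne (by omega), iff_of_false this.not_gt (by omega)⟩
      · have := SimpleGraph.cnlExcess_one_pos (t := t) (b := z) ht hz1 (by omega) (by omega)
        exact ⟨iff_of_false this.ne' (by omega), iff_of_true this (by omega)⟩
    · rcases eq_or_lt_of_le hz1 with hz1 | hz2
      · rw [← hz1] at h1
        rw [← hz1, mul_one] at h0'
        obtain ⟨hS1, hS2⟩ := SimpleGraph.not_cnsl_energetic_of_isolated hadj h0' h1 h2 ht
        exact ⟨iff_of_false hS1 (by omega), iff_of_false hS2 (by simp only [hodd, true_and]; omega)⟩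
      obtain ⟨hS1, hS2⟩ := SimpleGraph.cnsl_energetic_iff hadj h0' h1 (Or.inl ⟨rfl, h2⟩) ht
        hz2.le (Or.inl hz2)
      rw [hS1, hS2]
      push_cast
      by_cases hex : (z = 2 ∧ (t = 2 ∨ t = 3 ∨ t = 4)) ∨ t = 2 ∧ (z = 3 ∨ z = 4)
      · have := SimpleGraph.cnslExcess_one_neg hex
        exact ⟨iff_of_false this.ne (by omega), iff_of_false this.not_gt (by omega)⟩
      · have := SimpleGraph.cnslExcess_one_pos (t := t) (b := z) ht hz2 (by omega) (by omega)
        exact ⟨iff_of_false this.ne' (by omega), iff_of_true this (by omega)⟩
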